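/- **Setting.** Let $S$ be a finite set, $J\notin S$ a further symbol, and let $\langle S\cup\{J\} : R\rangle$ be a finite presentation in which every relation has the form $J^p w=1$ with $p\in\mathbb Z_2$ and $w\in\mathcal F(S)$. Put $S'=\{u_s,v_s : s\in S\}$, let $\phi_1:\mathcal F(S)\to\mathcal F(S')$ be the homomorphism $s\mapsto u_sv_su_sv_s$, and for $x\in\mathcal F(S')$ with reduced word $t_1^{\pm1}\cdots t_k^{\pm1}$ let $x^+=t_1\cdots t_k$. Let $R'=\{J^p\phi_1(w)^+ : J^pw\in R\}$. The *wagon wheel system* $Mx=c$ is the following linear system over $\mathbb Z_2$. Its variables are the elements of $S'$ together with, for each $r=J^ps_1\cdots s_N\in R'$ ($s_i\in S'$), ancillary variables $a^r_i,b^r_i,c^r_i,d^r_i$, $1\le i\le N$. Its equations are, for each such $r$ and $1\le i\le N$ (indices $i$ modulo $N$), $$s_i+a^r_i+b^r_i=\begin{cases}p & i=1\\ 0 & i\ne1\end{cases},\qquad b^r_i+c^r_i+a^r_{i+1}=0,\qquad c^r_i+d^r_i+d^r_{i+1}=0 .$$ Number the equations $1,\dots,m$ and the variables $1,\dots,n$,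 and let $V_i=\{j : M_{ij}\neq0\}$. The *solution group* $\Gamma=\Gamma_{Mx=c}$ is generated by $x_1,\dots,x_n,J$ with relations $J^2=x_j^2=[x_j,J]=1$, $\prod_j x_j^{M_{ij}}=J^{c_i}$ for all $i$, and $[x_j,x_k]=1$ whenever $j,k\in V_i$ for some $i$. In the *linear system game* $\mathcal G_{Mx=c}$ (for $M\ne0$), Alice and Bob receive $i$ and $j$, where $(i,j)$ is uniform on the pairs with $j\in V_i$; Alice answers $a\in\mathcal O_A^i=\{a\in\mathbb Z_2^{V_i}:\sum_{j\in V_i}a_j=c_i\}$, Bob answers $b\in\mathbb Z_2$, and they win iff $j\notin V_i$ or $a_j=b$. A *commuting-operator strategy* $\mathcal S$ consists of a Hilbert space $\mathcal H$, a unit vector $\psi\in\mathcal H$, and projective measurements $\{P^i_a\}_{a\in\mathcal O_A^i}$ $(1\le i\le m)$ and $\{Q^j_b\}_{b\in\mathbb Z_2}$ $(1\le j\le n)$ on $\mathcal H$ such that every $P^i_a$ commutes with every $Q^j_b$; its winning probability $\omega(\mathcal G_{Mx=c};\mathcal S)$ is the probability of winning when $(a,b)$ has probability $\langle\psi|P^i_aQ^j_b|\psi\rangle$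 given $(i,j)$. **Proposition 4.3.** Let $Mx=c$ be a wagon wheel system with $M\neq0$, and suppose $J\neq1$ in $\Gamma$. Then $\mathcal G_{Mx=c}$ has a commuting-operator strategy $\mathcal S$ with $\omega(\mathcal G_{Mx=c};\mathcal S)=1$ and $$\langle\psi|P^i_aQ^j_b|\psi\rangle=\begin{cases}\dfrac{1+(-1)^{a_j+b}}8 & j\in V_i\\[2mm] \dfrac18 & j\notin V_i\end{cases}$$ for all $1\le i\le m$, $a\in\mathcal O^i_A$, $1\le j\le n$, $b\in\mathbb Z_2$. Moreover $\mathcal S$ can be built from the left and right regular representations $L,R$ of $\Gamma$ on $\ell^2\Gamma$, given by $L(g)|h\rangle=|gh\rangle$ and $R(g)|h\rangle=|hg^{-1}\rangle$: one can take $\mathcal H=\{\xi\in\ell^2\Gamma : L(J)\xi=-\xi\}$ and $\psi=\frac1{\sqrt2}(|1\rangle-|J\rangle)$, with observables $\sum_{a\in\mathcal O_A^i}(-1)^{a_j}P^i_a=L(x_j)|_{\mathcal H}$ for $j\in V_i$ and $Q^j_0-Q^j_1=R(x_j)|_{\mathcal H}$ for all $j$. -/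

import Mathlib

open scoped commutatorElement

/-! ## Non-local games and approximately-commuting operator strategies -/

/-- A two-player non-local game on the Bell scenario with (finite) input sets `IA`, `IB` and output
sets `OA x`, `OB y`: the predicate `V(a,b|x,y)` and the probability distribution `π` on inputs. -/
structure NonlocalGame {IA IB : Type*} [Fintype IA] [Fintype IB]
    (OA : IA → Type*) (OB : IB → Type*) where
  V : ∀ (x : IA) (y : IB), OA x → OB y → Bool
  π : IA → IB → ℝ
  π_nonneg : ∀ x y, 0 ≤ π x y
  π_sum : ∑ x, ∑ y, π x y = 1

/-- A `δ`-approximately-commuting operator strategy on the Hilbert space `H`: projective measurements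
(finite families of self-adjoint projections with sum `1`; such projections are automatically
pairwise orthogonal) for every input, and a state (unit vector). -/
structure ACStrategy {IA IB : Type*} (OA : IA → Type*) (OB : IB → Type*)
    [∀ x, Fintype (OA x)] [∀ y, Fintype (OB y)] (δ : ℝ)
    (H : Type*) [NormedAddCommGroup H] [InnerProductSpace ℂ H] [CompleteSpace H] where
  P : ∀ x, OA x → H →L[ℂ] H
  Q : ∀ y, OB y → H →L[ℂ] H
  P_proj : ∀ x a, IsStarProjection (P x a)
  Q_proj : ∀ y b, IsStarProjection (Q y b)
  P_sum : ∀ x, ∑ a, P x a = 1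
  Q_sum : ∀ y, ∑ b, Q y b = 1
  ψ : H
  norm_ψ : ‖ψ‖ = 1
  comm : ∀ x y a b, ‖P x a * Q y b - Q y b * P x a‖ ≤ δ

/-- A commuting-operator strategy is a `0`-AC operator strategy. -/
noncomputable abbrev CommutingStrategy {IA IB : Type*} (OA : IA → Type*) (OB : IB → Type*)
    [∀ x, Fintype (OA x)] [∀ y, Fintype (OB y)]
    (H : Type*) [NormedAddCommGroup H] [InnerProductSpace ℂ H] [CompleteSpace H] :=
  ACStrategy OA OB 0 H

namespace ACStrategy

variable {IA IB : Type*} {OA : IA → Type*} {OB : IB → Type*}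
  [∀ x, Fintype (OA x)] [∀ y, Fintype (OB y)] {δ : ℝ}
  {H : Type*} [NormedAddCommGroup H] [InnerProductSpace ℂ H] [CompleteSpace H]

/-- The correlation `⟨ψ| P^x_a Q^y_b |ψ⟩`. -/
noncomputable def corr (𝒮 : ACStrategy OA OB δ H) (x : IA) (y : IB) (a : OA x) (b : OB y) : ℂ :=
  inner ℂ 𝒮.ψ (𝒮.P x a (𝒮.Q y b 𝒮.ψ))

/-- The winning probability `ω(𝒢; 𝒮)`. -/
noncomputable def winProb [Fintype IA] [Fintype IB] (𝒮 : ACStrategy OA OB δ H)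
    (𝒢 : NonlocalGame OA OB) : ℝ :=
  ‖∑ x, ∑ y, (𝒢.π x y : ℂ) * ∑ a, ∑ b, (if 𝒢.V x y a b then 1 else 0) * 𝒮.corr x y a b‖

end ACStrategy

/-! ## Linear systems over `ℤ/2`, their games and their solution groups -/

/-- A linear system `M x = c` over `ℤ/2` with equations indexed by `E` and variables by `X`. -/
structure LinSystem (E X : Type*) where
  M : Matrix E X (ZMod 2)
  c : E → ZMod 2

namespace LinSystem

variable {E X : Type*} [Fintype X]

/-- `V_i`, the set of variables that appear in equation `i`. -/
def supp (L : LinSystem E X) (i : E) : Finset X := {j | L.M i j ≠ 0}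

/-- Alice's outputs on input `i`: the satisfying assignments of equation `i`. -/
abbrev AliceOut (L : LinSystem E X) (i : E) : Type _ :=
  {a : L.supp i → ZMod 2 // ∑ j, a j = L.c i}

/-- Bob's outputs. -/
abbrev BobOut (_L : LinSystem E X) (_j : X) : Type := ZMod 2

instance [DecidableEq X] (L : LinSystem E X) (i : E) : Fintype (L.AliceOut i) :=
  Subtype.fintype _

/-- The pairs `(i, j)` with `j ∈ V_i`. -/
def incidences [Fintype E] (L : LinSystem E X) : Finset (E × X) := {q | L.M q.1 q.2 ≠ 0}

lemma incidences_nonempty [Fintype E] (L : LinSystem E X) (hM : L.M ≠ 0) :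
    L.incidences.Nonempty := by
  by_contra h
  apply hM
  ext i j
  by_contra hij
  exact h ⟨(i, j), by simpa [incidences] using hij⟩

/-- The linear system game. Its input distribution is uniform on the pairs `(i, j)` with `j ∈ V_i`,
so at least one such pair has to exist, that is, `M ≠ 0`. -/
noncomputable def game [Fintype E] [DecidableEq E] [DecidableEq X] (L : LinSystem E X)
    (hM : L.M ≠ 0) : NonlocalGame L.AliceOut L.BobOut where
  V i j a b := decide (∀ h : j ∈ L.supp i, a.1 ⟨j, h⟩ = b)
  π i j := if L.M i j ≠ 0 then 1 / (L.incidences.card : ℝ) else 0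
  π_nonneg i j := by split_ifs <;> positivity
  π_sum := by
    have h : ((L.incidences.card : ℕ) : ℝ) ≠ 0 :=
      Nat.cast_ne_zero.mpr (Finset.card_pos.mpr (L.incidences_nonempty hM)).ne'
    rw [← Fintype.sum_prod_type' (f := fun i j =>
      if L.M i j ≠ 0 then 1 / (L.incidences.card : ℝ) else 0), ← Finset.sum_filter]
    change ∑ _q ∈ L.incidences, 1 / (L.incidences.card : ℝ) = 1
    rw [Finset.sum_const, nsmul_eq_mul, mul_one_div_cancel h]

/-- The relators of the solution group, in the free group on `x_j = of (some j)`, `J = of none`.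
The product in `eqn` is taken in some fixed order; by `comm` the order is irrelevant. -/
inductive SolRel (L : LinSystem E X) : FreeGroup (Option X) → Prop
  | commJ (j : X) : SolRel L ⁅FreeGroup.of (some j), FreeGroup.of none⁆
  | sq (j : X) : SolRel L (FreeGroup.of (some j) ^ 2)
  | sqJ : SolRel L (FreeGroup.of none ^ 2)
  | eqn (i : E) : SolRel L
      (((L.supp i).toList.map fun j => FreeGroup.of (some j)).prod *
        (FreeGroup.of none ^ (L.c i).val)⁻¹)
  | comm (i : E) (j k : X) (hj : j ∈ L.supp i) (hk : k ∈ L.supp i) :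
      SolRel L ⁅FreeGroup.of (some j), FreeGroup.of (some k)⁆

/-- The solution group `Γ_{Mx=c}`. -/
abbrev SolutionGroup (L : LinSystem E X) : Type _ := PresentedGroup {r | L.SolRel r}

/-- The generator `x_j` of the solution group. -/
def gen (L : LinSystem E X) (j : X) : L.SolutionGroup := PresentedGroup.of (some j)

/-- The generator `J` of the solution group. -/
def genJ (L : LinSystem E X) : L.SolutionGroup := PresentedGroup.of none

section Observables

variable [DecidableEq X] {δ : ℝ} {H : Type*} [NormedAddCommGroup H] [InnerProductSpace ℂ H]
  [CompleteSpace H]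

/-- Alice's observable `A_{ij} = ∑_a (-1)^{a_j} P^i_a`, for `j ∈ V_i`. -/
noncomputable def obsA (L : LinSystem E X) (𝒮 : ACStrategy L.AliceOut L.BobOut δ H)
    (i : E) (j : L.supp i) : H →L[ℂ] H :=
  ∑ a : L.AliceOut i, (-1 : ℂ) ^ (a.1 j).val • 𝒮.P i a

/-- Bob's observable `B_j = Q^j_0 - Q^j_1`. -/
noncomputable def obsB (L : LinSystem E X) (𝒮 : ACStrategy L.AliceOut L.BobOut δ H)
    (j : X) : H →L[ℂ] H :=
  𝒮.Q j (0 : ZMod 2) - 𝒮.Q j (1 : ZMod 2)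

end Observables

end LinSystem

/-! ## Regular representations -/

/-- `ℓ²G`, the square-summable functions `G → ℂ`. -/
noncomputable abbrev EllTwo (G : Type*) := lp (fun _ : G => ℂ) 2

namespace EllTwo

open Classical in
/-- The basis vector `|g⟩`. -/
noncomputable def ket {G : Type*} (g : G) : EllTwo G := lp.single 2 g (1 : ℂ)

/-- The unitary `|h⟩ ↦ |σ h⟩` of `ℓ²G` given by a permutation `σ` of `G`. -/
noncomputable def perm {G : Type*} (σ : Equiv.Perm G) : EllTwo G ≃ₗᵢ[ℂ] EllTwo G where
  toFun f := ⟨fun h => f (σ.symm h), memℓp_gen (by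
    have h := (lp.memℓp f).summable (by norm_num)
    exact (σ.symm.summable_iff (f := fun i => ‖f i‖ ^ (2 : ENNReal).toReal)).mpr h)⟩
  invFun f := ⟨fun h => f (σ h), memℓp_gen (by
    have h := (lp.memℓp f).summable (by norm_num)
    exact (σ.summable_iff (f := fun i => ‖f i‖ ^ (2 : ENNReal).toReal)).mpr h)⟩
  map_add' f g := by ext h; rfl
  map_smul' c f := by ext h; rfl
  left_inv f := by ext h; simp
  right_inv f := by ext h; simp
  norm_map' f := by
    rw [lp.norm_eq_tsum_rpow (by norm_num), lp.norm_eq_tsum_rpow (by norm_num)]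
    congr 1
    exact σ.symm.tsum_eq (fun i => ‖f i‖ ^ (2 : ENNReal).toReal)

/-- The left regular representation, `L(g)|h⟩ = |gh⟩`. -/
noncomputable def leftReg {G : Type*} [Group G] (g : G) : EllTwo G ≃ₗᵢ[ℂ] EllTwo G :=
  perm (Equiv.mulLeft g)

/-- The right regular representation, `R(g)|h⟩ = |hg⁻¹⟩`. -/
noncomputable def rightReg {G : Type*} [Group G] (g : G) : EllTwo G ≃ₗᵢ[ℂ] EllTwo G :=
  perm (Equiv.mulRight g⁻¹)

/-- The closed subspace `{ξ ∈ ℓ²G : L(z) ξ = -ξ}`. -/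
noncomputable def negSubspace {G : Type*} [Group G] (z : G) : Submodule ℂ (EllTwo G) where
  carrier := {ξ | leftReg z ξ = -ξ}
  add_mem' {ξ η} hξ hη := by
    simp only [Set.mem_ofPred_eq] at hξ hη ⊢
    rw [map_add, hξ, hη, neg_add]
  zero_mem' := by simp
  smul_mem' c ξ hξ := by
    simp only [Set.mem_ofPred_eq] at hξ ⊢
    rw [map_smul, hξ, smul_neg]

instance {G : Type*} [Group G] (z : G) : CompleteSpace (negSubspace z) :=
  (isClosed_eq (leftReg z).continuous continuous_neg :
    IsClosed (negSubspace z : Set (EllTwo G))).completeSpace_coe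

end EllTwo

/-! ## The wagon wheel construction -/

namespace WagonWheel

/-- The homomorphism `φ₁` on the generators `s ≠ J`: `φ₁(s) = u_s v_s u_s v_s`, where
`u_s = (s, false)` and `v_s = (s, true)`. -/
def phi {S : Type*} : FreeGroup S →* FreeGroup (S × Bool) :=
  FreeGroup.lift fun s =>
    FreeGroup.of (s, false) * FreeGroup.of (s, true) *
      FreeGroup.of (s, false) * FreeGroup.of (s, true)

/-- `x⁺ = s₁ ⋯ s_k`, where `s₁^{±1} ⋯ s_k^{±1}` is the reduced word of `x`. -/
def plus {T : Type*} [DecidableEq T] (x : FreeGroup T) : List T := x.toWord.map Prod.fst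

/-- The words `φ₁(r)⁺` for the relations `r` of a presentation. A pair `(p, w)` stands for the
relation `J^p w = 1`, where `w` does not contain `J`. -/
def evenRelations {S : Type*} [DecidableEq S] (R : Finset (ZMod 2 × FreeGroup S)) :
    Finset (ZMod 2 × List (S × Bool)) :=
  R.image fun r => (r.1, plus (phi r.2))

section Wheel

variable {T : Type*}

/-- The ancillary variables: `a_i, b_i, c_i, d_i` is `⟨r, i, 0⟩, ⟨r, i, 1⟩, ⟨r, i, 2⟩, ⟨r, i, 3⟩`,
for every relation `r = J^p s_1 ⋯ s_n` and position `i` in `r` (positions start at `0`). -/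
abbrev Anc (R' : Finset (ZMod 2 × List T)) : Type _ :=
  (r : R') × (Fin r.1.2.length × Fin 4)

/-- The variables of the system: the letters and the ancillary variables. -/
abbrev Var (R' : Finset (ZMod 2 × List T)) : Type _ := T ⊕ Anc R'

instance [DecidableEq T] (R' : Finset (ZMod 2 × List T)) : DecidableEq (Var R') :=
  inferInstance

/-- The vertices of the wheels, three for every position `i` of every relation. -/
abbrev Vertex (R' : Finset (ZMod 2 × List T)) : Type _ :=
  (r : R') × (Fin r.1.2.length × Fin 3)

/-- The hyperedges (variables) incident to a vertex: with `i + 1` read cyclically,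
* kind `0`, on the outer cycle: `s_i, a_i, b_i`;
* kind `1`, on the outer cycle, at the end of a spoke: `b_i, c_i, a_{i+1}`;
* kind `2`, on the inner cycle: `c_i, d_i, d_{i+1}`. -/
def incident [DecidableEq T] (R' : Finset (ZMod 2 × List T)) : Vertex R' → Finset (Var R')
  | ⟨r, i, 0⟩ => {.inl (r.1.2.get i), .inr ⟨r, i, 0⟩, .inr ⟨r, i, 1⟩}
  | ⟨r, i, 1⟩ => {.inr ⟨r, i, 1⟩, .inr ⟨r, i, 2⟩, .inr ⟨r, finRotate _ i, 0⟩}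
  | ⟨r, i, 2⟩ => {.inr ⟨r, i, 2⟩, .inr ⟨r, i, 3⟩, .inr ⟨r, finRotate _ i, 3⟩}

/-- The colour of a vertex: `p` for the vertex attached to the first letter of `J^p s_1 ⋯ s_n`,
and `0` for all the others. -/
def colour (R' : Finset (ZMod 2 × List T)) : Vertex R' → ZMod 2
  | ⟨r, i, k⟩ => if i.val = 0 ∧ k = 0 then r.1.1 else 0

/-- The linear system given by the wheels of all the relations in `R'`. -/
def wheelSystem [DecidableEq T] (R' : Finset (ZMod 2 × List T)) :
    LinSystem (Vertex R') (Var R') where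
  M := Matrix.of fun v x => if x ∈ incident R' v then 1 else 0
  c := colour R'

end Wheel

/-- The wagon wheel linear system of the presentation with generators `S ∪ {J}` and relations
`J^p w = 1` for `(p, w) ∈ R`. -/
def system {S : Type*} [DecidableEq S] (R : Finset (ZMod 2 × FreeGroup S)) :
    LinSystem (Vertex (evenRelations R)) (Var (evenRelations R)) :=
  wheelSystem (evenRelations R)

end WagonWheel

/-! `J` is central, so `L` and `R` restrict to the `-1`-eigenspace of `L(J)`, where `J` acts as the
scalar `-1`. The relations of `Γ` become operator identities: the `L(x_j)` are self-adjoint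
involutions obeying the equations, and they commute with every `R(x_k)`. In the state `(|1⟩ -
|J⟩)/√2` the expectation of `L(g)R(h)` is `[g = h] - [g = Jh]` (`inner_negState`). The correlations
therefore only require that `x_j ∉ {1, J}`, and that `x_j ∉ {x_k, J x_k}` for `j ≠ k`. Every
equation has exactly three variables, so Alice's projections are averages over signed Klein
four-groups and their correlations are linear in the observables. The group-theoretic facts come
from abelian quotients. A solution of the homogeneous system gives a `ℤ/2`-valued character that
kills `J` (`character`), so it suffices that such solutions are non-zero at each variable and
separate any two variables (`exists_solution_ne_zero`, `exists_solution_ne`). Each letter occurs an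
even number of times in `φ₁(w)⁺`, so arbitrary letter values extend consistently around every wheel.
Wheels of length 1 and 2, which would be degenerate, do not occur (`length_plus_phi`). -/

/-! ### Regular representations on the `-1`-eigenspace of a central involution -/

namespace EllTwo

variable {G : Type*}

lemma perm_apply (σ : Equiv.Perm G) (f : EllTwo G) (h : G) : perm σ f h = f (σ.symm h) := rfl

lemma perm_ket (σ : Equiv.Perm G) (g : G) : perm σ (ket g) = ket (σ g) := by
  classical
  ext h
  rw [perm_apply]
  simp only [ket, lp.single_apply, Pi.single_apply]
  simp only [Equiv.symm_apply_eq]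

open Classical in
lemma inner_ket_ket (g h : G) :
    inner ℂ (ket g) (ket h) = if g = h then (1 : ℂ) else 0 := by
  rw [ket, lp.inner_single_left]
  simp only [ket, lp.single_apply, Pi.single_apply]
  split_ifs <;> simp

variable [Group G]

lemma leftReg_ket (g h : G) : leftReg g (ket h) = ket (g * h) := perm_ket _ _

lemma rightReg_ket (g h : G) : rightReg g (ket h) = ket (h * g⁻¹) := perm_ket _ _

lemma leftReg_apply (g : G) (f : EllTwo G) (h : G) : leftReg g f h = f (g⁻¹ * h) := rfl

lemma rightReg_apply (g : G) (f : EllTwo G) (h : G) : rightReg g f h = f (h * g) := by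
  rw [rightReg, perm_apply]
  simp

lemma leftReg_mul (g h : G) (f : EllTwo G) : leftReg (g * h) f = leftReg g (leftReg h f) := by
  ext k
  simp [leftReg_apply, mul_assoc]

lemma rightReg_mul (g h : G) (f : EllTwo G) : rightReg (g * h) f = rightReg g (rightReg h f) := by
  ext k
  simp [rightReg_apply, mul_assoc]

lemma leftReg_one (f : EllTwo G) : leftReg (1 : G) f = f := by
  ext k
  simp [leftReg_apply]

lemma rightReg_one (f : EllTwo G) : rightReg (1 : G) f = f := by
  ext k
  simp [rightReg_apply]

lemma leftReg_rightReg (g h : G) (f : EllTwo G) :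
    leftReg g (rightReg h f) = rightReg h (leftReg g f) := by
  ext k
  simp [leftReg_apply, rightReg_apply, mul_assoc]

variable {z : G}

lemma mem_negSubspace {ξ : EllTwo G} : ξ ∈ negSubspace z ↔ leftReg z ξ = -ξ := Iff.rfl

lemma leftReg_mem (hz : ∀ g, Commute z g) (g : G) {ξ : EllTwo G} (hξ : ξ ∈ negSubspace z) :
    leftReg g ξ ∈ negSubspace z := by
  rw [mem_negSubspace] at *
  rw [← leftReg_mul, (hz g).eq, leftReg_mul, hξ, map_neg]

lemma rightReg_mem (g : G) {ξ : EllTwo G} (hξ : ξ ∈ negSubspace z) :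
    rightReg g ξ ∈ negSubspace z := by
  rw [mem_negSubspace] at *
  rw [leftReg_rightReg, hξ, map_neg]

/-- The restriction of `L(g)` to the `-1`-eigenspace of a central element. -/
noncomputable def negLeft (hz : ∀ g, Commute z g) (g : G) : negSubspace z →L[ℂ] negSubspace z :=
  ((leftReg g).toContinuousLinearEquiv.toContinuousLinearMap.comp
    (negSubspace z).subtypeL).codRestrict _ fun ξ => leftReg_mem hz g ξ.2

/-- The restriction of `R(g)` to the `-1`-eigenspace of `L(z)`. -/
noncomputable def negRight (z g : G) : negSubspace z →L[ℂ] negSubspace z :=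
  ((rightReg g).toContinuousLinearEquiv.toContinuousLinearMap.comp
    (negSubspace z).subtypeL).codRestrict _ fun ξ => rightReg_mem g ξ.2

lemma negLeft_one (hz : ∀ g, Commute z g) : negLeft hz 1 = 1 := by
  ext1 ξ
  exact Subtype.ext (leftReg_one _)

lemma negRight_one : negRight z 1 = 1 := by
  ext1 ξ
  exact Subtype.ext (rightReg_one _)

lemma negLeft_mul (hz : ∀ g, Commute z g) (g h : G) :
    negLeft hz (g * h) = negLeft hz g * negLeft hz h := by
  ext1 ξ
  exact Subtype.ext (leftReg_mul _ _ _)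

lemma negRight_mul (g h : G) : negRight z (g * h) = negRight z g * negRight z h := by
  ext1 ξ
  exact Subtype.ext (rightReg_mul _ _ _)

lemma negLeft_self (hz : ∀ g, Commute z g) : negLeft hz z = -1 := by
  ext1 ξ
  exact Subtype.ext ξ.2

/-- Turns the group element `J^c` on the right of an equation into the sign `(-1)^c`. -/
lemma negLeft_pow_mul (hz : ∀ g, Commute z g) (n : ℕ) (g : G) :
    negLeft hz (z ^ n * g) = (-1 : ℂ) ^ n • negLeft hz g := by
  induction n with
  | zero => simp
  | succ n ih =>
    rw [pow_succ', mul_assoc, negLeft_mul, ih, negLeft_self, pow_succ', mul_smul]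
    ext1 ξ
    simp

lemma negLeft_negRight (hz : ∀ g, Commute z g) (g h : G) :
    Commute (negLeft hz g) (negRight z h) := by
  ext1 ξ
  exact Subtype.ext (leftReg_rightReg _ _ _)

/-- A unitary that squares to the identity is its own adjoint. -/
lemma isSelfAdjoint_negLeft (hz : ∀ g, Commute z g) {g : G} (hg : g * g = 1) :
    IsSelfAdjoint (negLeft hz g) := by
  rw [ContinuousLinearMap.isSelfAdjoint_iff_isSymmetric]
  intro ξ η
  change inner ℂ (leftReg g (ξ : EllTwo G)) (η : EllTwo G) =
    inner ℂ (ξ : EllTwo G) (leftReg g (η : EllTwo G))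
  rw [← (leftReg g).inner_map_map, ← leftReg_mul, hg, leftReg_one]

lemma isSelfAdjoint_negRight {g : G} (hg : g * g = 1) :
    IsSelfAdjoint (negRight z g) := by
  rw [ContinuousLinearMap.isSelfAdjoint_iff_isSymmetric]
  intro ξ η
  change inner ℂ (rightReg g (ξ : EllTwo G)) (η : EllTwo G) =
    inner ℂ (ξ : EllTwo G) (rightReg g (η : EllTwo G))
  rw [← (rightReg g).inner_map_map, ← rightReg_mul, hg, rightReg_one]

/-- The vector `(|1⟩ - |z⟩) / √2`. -/
noncomputable def negState (hz2 : z * z = 1) : negSubspace z :=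
  ⟨((1 / Real.sqrt 2 : ℝ) : ℂ) • (ket 1 - ket z), by
    rw [mem_negSubspace, map_smul, map_sub, leftReg_ket, leftReg_ket, hz2, mul_one, ← smul_neg,
      neg_sub]⟩

-- `L(g)R(h)` sends `|k⟩` to `|g k h⁻¹⟩`. Since `z` is a central involution, the two diagonal terms
-- both test `g = h` and the two cross terms, which carry a minus sign, both test `g = zh`.
open Classical in
lemma inner_negState (hz : ∀ g, Commute z g) (hz2 : z * z = 1) (g h : G) :
    inner ℂ (negState hz2) (negLeft hz g (negRight z h (negState hz2))) =
      (if g = h then (1 : ℂ) else 0) - if g = z * h then 1 else 0 := by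
  change inner ℂ (((1 / Real.sqrt 2 : ℝ) : ℂ) • (ket 1 - ket z) : EllTwo G)
    (leftReg g (rightReg h (((1 / Real.sqrt 2 : ℝ) : ℂ) • (ket 1 - ket z)))) = _
  have hs : ((1 / Real.sqrt 2 : ℝ) : ℂ) * ((1 / Real.sqrt 2 : ℝ) : ℂ) = 1 / 2 := by
    rw [← Complex.ofReal_mul, div_mul_div_comm, Real.mul_self_sqrt (by norm_num)]
    norm_num
  have e1 : (1 = g * (1 * h⁻¹)) ↔ g = h := by
    rw [one_mul, eq_comm, mul_inv_eq_one]
  have e2 : (1 = g * (z * h⁻¹)) ↔ g = z * h := by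
    rw [← mul_assoc, eq_comm, mul_inv_eq_one, ← (hz g).eq, ← mul_right_inj z, ← mul_assoc, hz2,
      one_mul]
  have e3 : (z = g * (1 * h⁻¹)) ↔ g = z * h := by
    rw [one_mul, eq_mul_inv_iff_mul_eq, eq_comm]
  have e4 : (z = g * (z * h⁻¹)) ↔ g = h := by
    rw [← mul_assoc, eq_mul_inv_iff_mul_eq, ← (hz g).eq, mul_right_inj, eq_comm]
  simp only [map_smul, map_sub, rightReg_ket, leftReg_ket, inner_smul_left, inner_smul_right,
    inner_sub_left, inner_sub_right, inner_ket_ket, Complex.conj_ofReal, e1, e2, e3, e4]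
  linear_combination (2 * (if g = h then (1 : ℂ) else 0) - 2 * if g = z * h then 1 else 0) * hs

end EllTwo

/-! ### Sign sums over the solutions of one equation in three variables -/

section Sign

lemma neg_one_pow_val_add (a b : ZMod 2) :
    (-1 : ℂ) ^ (a + b).val = (-1) ^ a.val * (-1) ^ b.val := by
  have h : ∀ a b : ZMod 2, (-1 : ℤ) ^ (a + b).val = (-1) ^ a.val * (-1) ^ b.val := by decide
  exact_mod_cast congrArg (Int.cast : ℤ → ℂ) (h a b)

lemma neg_one_pow_val_mul_self (a : ZMod 2) : (-1 : ℂ) ^ a.val * (-1) ^ a.val = 1 := by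
  rw [← mul_pow]
  norm_num

lemma isSelfAdjoint_neg_one_pow (n : ℕ) : IsSelfAdjoint ((-1 : ℂ) ^ n) :=
  ((IsSelfAdjoint.one ℂ).neg).pow n

variable {V : Type*} [Fintype V]

/-- The affine hyperplane of sign patterns on a three-element set transported to `Fin 3`. -/
lemma sum_affine_eq {c : ZMod 2} [Fintype {a : V → ZMod 2 // ∑ j, a j = c}] (e : V ≃ Fin 3)
    (F : (V → ZMod 2) → ℂ) :
    ∑ a : {a : V → ZMod 2 // ∑ j, a j = c}, F a.1 =
      ∑ a : {a : Fin 3 → ZMod 2 // ∑ j, a j = c}, F (a.1 ∘ e) := by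
  refine Fintype.sum_equiv ((e.arrowCongr (Equiv.refl _)).subtypeEquiv fun a => ?_) _ _ fun a => ?_
  · rw [← e.symm.sum_comp]
    rfl
  · congr 1
    ext j
    simp [Equiv.arrowCongr]

variable {c : ZMod 2} [Fintype {a : V → ZMod 2 // ∑ j, a j = c}] (hV : Fintype.card V = 3)

include hV

lemma sum_affine_one : ∑ _a : {a : V → ZMod 2 // ∑ j, a j = c}, (1 : ℂ) = 4 := by
  rw [sum_affine_eq (Fintype.equivFinOfCardEq hV) fun _ => 1]
  have h : ∀ c : ZMod 2, ∑ _a : {a : Fin 3 → ZMod 2 // ∑ j, a j = c}, (1 : ℤ) = 4 := by decide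
  exact_mod_cast congrArg (Int.cast : ℤ → ℂ) (h c)

lemma sum_affine_sign (j : V) :
    ∑ a : {a : V → ZMod 2 // ∑ j, a j = c}, (-1 : ℂ) ^ (a.1 j).val = 0 := by
  rw [sum_affine_eq (Fintype.equivFinOfCardEq hV) fun a => (-1) ^ (a j).val]
  have h : ∀ (c : ZMod 2) (j : Fin 3),
    ∑ a : {a : Fin 3 → ZMod 2 // ∑ j, a j = c}, (-1 : ℤ) ^ (a.1 j).val = 0 := by decide
  exact_mod_cast congrArg (Int.cast : ℤ → ℂ) (h c _)

/-- Any two of the three coordinates are free on the plane and determine the third, so distinct sign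
functions are orthogonal. -/
lemma sum_affine_sign_mul_sign [DecidableEq V] (j k : V) :
    ∑ a : {a : V → ZMod 2 // ∑ j, a j = c}, (-1 : ℂ) ^ (a.1 j).val * (-1) ^ (a.1 k).val =
      if j = k then 4 else 0 := by
  rw [sum_affine_eq (Fintype.equivFinOfCardEq hV) fun a => (-1) ^ (a j).val * (-1) ^ (a k).val]
  have h : ∀ (c : ZMod 2) (j k : Fin 3),
    ∑ a : {a : Fin 3 → ZMod 2 // ∑ j, a j = c}, (-1 : ℤ) ^ (a.1 j).val * (-1) ^ (a.1 k).val =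
      if j = k then 4 else 0 := by decide
  have h' := congrArg (Int.cast : ℤ → ℂ)
    (h c (Fintype.equivFinOfCardEq hV j) (Fintype.equivFinOfCardEq hV k))
  simp only [EmbeddingLike.apply_eq_iff_eq] at h'
  push_cast at h'
  exact h'

end Sign

/-! ### Joint spectral projections of three observables -/

section JointProj

variable {𝔄 : Type*} [Ring 𝔄] [Algebra ℂ 𝔄] {V : Type*} [Fintype V]

/-- The joint spectral projection, for the signs `a`, of three commuting involutions whose product
is a scalar. -/
noncomputable def jointProj (X : V → 𝔄) (a : V → ZMod 2) : 𝔄 :=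
  (1 / 4 : ℂ) • (1 + ∑ j, (-1 : ℂ) ^ (a j).val • X j)

/-- For signs that satisfy the equation the scalar `(-1)^c` is absorbed, so the signed observables
multiply exactly as in a Klein four-group. -/
lemma smul_mul_smul_of_prod {x y z : 𝔄} {α β γ c : ZMod 2} (h : x * y = (-1 : ℂ) ^ c.val • z)
    (hs : α + β + γ = c) :
    ((-1 : ℂ) ^ α.val • x) * ((-1 : ℂ) ^ β.val • y) = (-1 : ℂ) ^ γ.val • z := by
  have : α + β + c = γ := by
    clear h
    revert α β γ c
    decide
  rw [smul_mul_smul_comm, h, smul_smul, ← neg_one_pow_val_add, ← neg_one_pow_val_add, this]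

lemma commute_jointProj {X : V → 𝔄} {y : 𝔄} (h : ∀ j, Commute (X j) y) (a : V → ZMod 2)
    (α β : ℂ) : Commute (jointProj X a) (α • (1 + β • y)) := by
  refine Commute.smul_left (Commute.smul_right (Commute.add_right (Commute.one_right _)
    (Commute.smul_right (Commute.add_left (Commute.one_left _) ?_) _)) _) _
  exact Commute.sum_left _ _ _ fun k _ => Commute.smul_left (h k) _

variable {c : ZMod 2} [Fintype {a : V → ZMod 2 // ∑ j, a j = c}] (hV : Fintype.card V = 3)

include hV

lemma sum_jointProj (X : V → 𝔄) :
    ∑ a : {a : V → ZMod 2 // ∑ j, a j = c}, jointProj X a.1 = 1 := by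
  simp only [jointProj, ← Finset.smul_sum, Finset.sum_add_distrib]
  rw [Finset.sum_comm]
  simp only [← Finset.sum_smul, sum_affine_sign hV, zero_smul, Finset.sum_const_zero, add_zero]
  have h : ∑ _a : {a : V → ZMod 2 // ∑ j, a j = c}, (1 : 𝔄) = (4 : ℂ) • 1 := by
    rw [← sum_affine_one (c := c) hV, Finset.sum_smul, one_smul]
  rw [h, smul_smul]
  norm_num

/-- Orthogonality of the signs annihilates every term except that of `X k`, whose coefficient is `4
· 1/4`. -/
lemma sum_sign_smul_jointProj (X : V → 𝔄) (k : V) :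
    ∑ a : {a : V → ZMod 2 // ∑ j, a j = c}, (-1 : ℂ) ^ (a.1 k).val • jointProj X a.1 = X k := by
  classical
  simp only [jointProj, smul_comm _ (1 / 4 : ℂ), ← Finset.smul_sum]
  simp only [smul_add, Finset.sum_add_distrib, Finset.smul_sum (s := Finset.univ (α := V)),
    smul_smul _ _ (X _)]
  rw [Finset.sum_comm (s := Finset.univ (α := {a : V → ZMod 2 // ∑ j, a j = c}))]
  simp only [← Finset.sum_smul, sum_affine_sign hV, sum_affine_sign_mul_sign hV, zero_smul,
    zero_add, ite_smul, smul_zero, Finset.sum_ite_eq, Finset.mem_univ, if_true, smul_smul]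
  norm_num

end JointProj

section Projections

variable {𝔄 : Type*} [Ring 𝔄] [StarRing 𝔄] [Algebra ℂ 𝔄] [StarModule ℂ 𝔄]

/-- The projection onto the `(-1)^b`-eigenspace of an involution. -/
lemma isStarProjection_involution {x : 𝔄} (hx : IsSelfAdjoint x) (hxx : x * x = 1) (b : ZMod 2) :
    IsStarProjection ((1 / 2 : ℂ) • (1 + (-1 : ℂ) ^ b.val • x)) where
  isIdempotentElem := by
    unfold IsIdempotentElem
    simp only [smul_mul_smul_comm, mul_add, add_mul, one_mul, mul_one, hxx,
      neg_one_pow_val_mul_self]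
    module
  isSelfAdjoint := by
    refine IsSelfAdjoint.smul ?_ ((IsSelfAdjoint.one _).add
      (IsSelfAdjoint.smul (isSelfAdjoint_neg_one_pow _) hx))
    simp [isSelfAdjoint_iff]

/-- The element is the average over a represented Klein four-group, hence the projection onto its
invariants. -/
lemma isStarProjection_klein {x y z : 𝔄} (hx : IsSelfAdjoint x) (hy : IsSelfAdjoint y)
    (hz : IsSelfAdjoint z) (hxx : x * x = 1) (hyy : y * y = 1) (hzz : z * z = 1)
    (hxy : x * y = z) (hyx : y * x = z) (hxz : x * z = y) (hzx : z * x = y)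
    (hyz : y * z = x) (hzy : z * y = x) :
    IsStarProjection ((1 / 4 : ℂ) • (1 + (x + y + z))) where
  isIdempotentElem := by
    unfold IsIdempotentElem
    simp only [smul_mul_smul_comm, mul_add, add_mul, one_mul, mul_one, hxx, hyy, hzz, hxy, hyx,
      hxz, hzx, hyz, hzy]
    module
  isSelfAdjoint := by
    refine IsSelfAdjoint.smul ?_ ((IsSelfAdjoint.one _).add ((hx.add hy).add hz))
    simp [isSelfAdjoint_iff]

variable {V : Type*} [Fintype V]

lemma isStarProjection_jointProj (hV : Fintype.card V = 3) (X : V → 𝔄) (c : ZMod 2)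
    (hX : ∀ j, IsSelfAdjoint (X j)) (hXX : ∀ j, X j * X j = 1)
    (hprod : ∀ i j k, i ≠ j → i ≠ k → j ≠ k → X i * X j = (-1 : ℂ) ^ c.val • X k)
    (a : V → ZMod 2) (ha : ∑ j, a j = c) : IsStarProjection (jointProj X a) := by
  let e := (Fintype.equivFinOfCardEq hV).symm
  rw [← e.sum_comp, Fin.sum_univ_three] at ha
  rw [jointProj, ← e.sum_comp, Fin.sum_univ_three]
  have hs : ∀ j, IsSelfAdjoint ((-1 : ℂ) ^ (a j).val • X j) := fun j =>
    IsSelfAdjoint.smul (isSelfAdjoint_neg_one_pow _) (hX j)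
  have h2 : ∀ j, ((-1 : ℂ) ^ (a j).val • X j) * ((-1 : ℂ) ^ (a j).val • X j) = 1 := fun j => by
    rw [smul_mul_smul_comm, hXX, neg_one_pow_val_mul_self, one_smul]
  have hp : ∀ i j k : Fin 3, i ≠ j → i ≠ k → j ≠ k →
      X (e i) * X (e j) = (-1 : ℂ) ^ c.val • X (e k) := fun i j k hij hik hjk =>
    hprod _ _ _ (e.injective.ne hij) (e.injective.ne hik) (e.injective.ne hjk)
  refine isStarProjection_klein (hs _) (hs _) (hs _) (h2 _) (h2 _) (h2 _) ?_ ?_ ?_ ?_ ?_ ?_ <;>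
    refine smul_mul_smul_of_prod (hp _ _ _ ?_ ?_ ?_) (Eq.trans ?_ ha) <;> first | decide | ring

end Projections

/-! ### Relations in the solution group -/

namespace LinSystem

variable {E X : Type*} [Fintype X] (L : LinSystem E X)

lemma gen_mul_self (j : X) : L.gen j * L.gen j = 1 := by
  rw [← sq]
  exact PresentedGroup.one_of_mem (SolRel.sq (L := L) j)

lemma genJ_mul_self : L.genJ * L.genJ = 1 := by
  rw [← sq]
  exact PresentedGroup.one_of_mem (SolRel.sqJ (L := L))

lemma commute_genJ (g : L.SolutionGroup) : Commute L.genJ g := by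
  have hg : g ∈ Subgroup.closure (Set.range
      (PresentedGroup.of (rels := {r | L.SolRel r}))) := by
    rw [PresentedGroup.closure_range_of]
    trivial
  induction hg using Subgroup.closure_induction with
  | mem x hx =>
    obtain ⟨_ | j, rfl⟩ := hx
    · exact Commute.refl _
    · exact (commutatorElement_eq_one_iff_commute.mp
        (PresentedGroup.one_of_mem (SolRel.commJ (L := L) j))).symm
  | one => exact Commute.one_right _
  | mul x y _ _ hx hy => exact hx.mul_right hy
  | inv x _ hx => exact hx.inv_right

variable {L}

lemma commute_gen {i : E} {j k : X} (hj : j ∈ L.supp i) (hk : k ∈ L.supp i) :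
    Commute (L.gen j) (L.gen k) :=
  commutatorElement_eq_one_iff_commute.mp
    (PresentedGroup.one_of_mem (SolRel.comm (L := L) i j k hj hk))

lemma prod_gen (i : E) :
    ((L.supp i).toList.map L.gen).prod = L.genJ ^ (L.c i).val := by
  have h := PresentedGroup.one_of_mem (rels := {r | L.SolRel r}) (SolRel.eqn i)
  rw [map_mul, map_inv, mul_inv_eq_one, map_pow, map_list_prod, List.map_map] at h
  exact h

/-- The generators of one equation commute, so its product may be reordered to `x, y, z`, and `z² =
1` moves the third factor across. -/
lemma gen_mul_gen {i : E} (hc : (L.supp i).card = 3) {x y z : X} (hx : x ∈ L.supp i)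
    (hy : y ∈ L.supp i) (hz : z ∈ L.supp i) (hxy : x ≠ y) (hxz : x ≠ z) (hyz : y ≠ z) :
    L.gen x * L.gen y = L.genJ ^ (L.c i).val * L.gen z := by
  classical
  have hs : L.supp i = {x, y, z} := by
    refine (Finset.eq_of_subset_of_card_le ?_ ?_).symm
    · simp [Finset.insert_subset_iff, hx, hy, hz]
    · rw [hc, Finset.card_eq_three.mpr ⟨x, y, z, hxy, hxz, hyz, rfl⟩]
  have hp : ([x, y, z].map L.gen).Perm ((L.supp i).toList.map L.gen) := by
    refine List.Perm.map _ ((List.perm_ext_iff_of_nodup ?_ (Finset.nodup_toList _)).mpr ?_)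
    · simp [hxy, hxz, hyz]
    · simp [hs]
  have h := hp.prod_eq' (by
    simp [commute_gen hx hy, commute_gen hx hz, commute_gen hy hz])
  rw [prod_gen] at h
  simp only [List.map_cons, List.map_nil, List.prod_cons, List.prod_nil, mul_one] at h
  rw [← h, ← mul_assoc, mul_assoc _ (L.gen z), gen_mul_self, mul_one]

/-! ### From correlated observables to a perfect strategy -/

section Strategy

variable {E X : Type*} [Fintype X] [DecidableEq X] {L : LinSystem E X}
  {H : Type*} [NormedAddCommGroup H] [InnerProductSpace ℂ H] [CompleteSpace H]

/-- Commuting families of `±1`-valued observables for Alice and Bob, Alice's satisfying the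
equations of `L`, together with a state in which they have vanishing expectations and are
correlated exactly when they belong to the same variable. -/
structure CorrelatedObservables (L : LinSystem E X) (H : Type*) [NormedAddCommGroup H]
    [InnerProductSpace ℂ H] [CompleteSpace H] where
  A : X → H →L[ℂ] H
  B : X → H →L[ℂ] H
  ψ : H
  isSelfAdjoint_A : ∀ j, IsSelfAdjoint (A j)
  A_mul_self : ∀ j, A j * A j = 1
  A_mul_A : ∀ i, ∀ x ∈ L.supp i, ∀ y ∈ L.supp i, ∀ z ∈ L.supp i, x ≠ y → x ≠ z → y ≠ z →
    A x * A y = (-1 : ℂ) ^ (L.c i).val • A z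
  isSelfAdjoint_B : ∀ j, IsSelfAdjoint (B j)
  B_mul_self : ∀ j, B j * B j = 1
  commute : ∀ j k, Commute (A j) (B k)
  inner_self : inner ℂ ψ ψ = (1 : ℂ)
  inner_A : ∀ j, inner ℂ ψ (A j ψ) = (0 : ℂ)
  inner_B : ∀ j, inner ℂ ψ (B j ψ) = (0 : ℂ)
  inner_A_B : ∀ j k, inner ℂ ψ (A j (B k ψ)) = if j = k then (1 : ℂ) else 0

namespace CorrelatedObservables

/-- The strategy measuring the joint spectral projections of the given observables, for a system
all of whose equations involve exactly three variables. -/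
noncomputable def strategy (D : L.CorrelatedObservables H) (hc : ∀ i, (L.supp i).card = 3) :
    CommutingStrategy L.AliceOut L.BobOut H where
  P i a := jointProj (fun j : L.supp i => D.A j) a.1
  Q j b := (1 / 2 : ℂ) • (1 + (-1 : ℂ) ^ (ZMod.val (n := 2) b) • D.B j)
  P_proj i a := isStarProjection_jointProj (V := L.supp i) (by rw [Fintype.card_coe, hc])
    (fun j => D.A j) (L.c i)
    (fun j => D.isSelfAdjoint_A j) (fun j => D.A_mul_self j)
    (fun x y z hxy hxz hyz => D.A_mul_A i x x.2 y y.2 z z.2 (Subtype.coe_ne_coe.mpr hxy)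
      (Subtype.coe_ne_coe.mpr hxz) (Subtype.coe_ne_coe.mpr hyz)) _ a.2
  Q_proj j b := isStarProjection_involution (D.isSelfAdjoint_B j) (D.B_mul_self j) _
  P_sum i := sum_jointProj (V := L.supp i) (by rw [Fintype.card_coe, hc]) fun j => D.A j
  Q_sum j := by
    have h01 : (0 : ZMod 2) ≠ 1 := by decide
    rw [show (Finset.univ : Finset (L.BobOut j)) = {(0 : ZMod 2), (1 : ZMod 2)} from rfl,
      Finset.sum_pair h01, ZMod.val_zero, ZMod.val_one]
    module
  ψ := D.ψ
  norm_ψ := by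
    rw [norm_eq_sqrt_re_inner (𝕜 := ℂ), D.inner_self]
    simp
  comm i j a b := by
    rw [(commute_jointProj (V := L.supp i) (fun k => D.commute k j) a.1 _ _).eq, sub_self,
      norm_zero]

variable (D : L.CorrelatedObservables H) {hc : ∀ i, (L.supp i).card = 3}

lemma obsA_strategy (i : E) (j : L.supp i) : L.obsA (D.strategy hc) i j = D.A j :=
  sum_sign_smul_jointProj (V := L.supp i) (by rw [Fintype.card_coe, hc]) (fun j : L.supp i => D.A j) j

lemma obsB_strategy (j : X) : L.obsB (D.strategy hc) j = D.B j := by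
  change (1 / 2 : ℂ) • (1 + (-1 : ℂ) ^ (ZMod.val (n := 2) 0) • D.B j) -
    (1 / 2 : ℂ) • (1 + (-1 : ℂ) ^ (ZMod.val (n := 2) 1) • D.B j) = _
  rw [ZMod.val_zero, ZMod.val_one]
  module

lemma corr_strategy (i : E) (j : X) (a : L.AliceOut i) (b : ZMod 2) :
    (D.strategy hc).corr i j a b =
      if h : j ∈ L.supp i then (1 + (-1) ^ (a.1 ⟨j, h⟩ + b).val) / 8 else 1 / 8 := by
  change inner ℂ D.ψ (jointProj (fun j : L.supp i => D.A j) a.1 (((1 / 2 : ℂ) •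
    (1 + (-1 : ℂ) ^ b.val • D.B j)) D.ψ)) = _
  simp only [jointProj, _root_.smul_apply, _root_.add_apply,
    one_apply_eq_self, _root_.sum_apply, map_add, map_smul,
    inner_add_right, inner_smul_right, inner_sum, D.inner_self, D.inner_A, D.inner_B, D.inner_A_B]
  by_cases hj : j ∈ L.supp i
  · rw [dif_pos hj, neg_one_pow_val_add]
    have : ∀ k : L.supp i, (k.1 = j) = (k = ⟨j, hj⟩) := fun k => by simp [Subtype.ext_iff]
    simp [this]
    ring
  · rw [dif_neg hj]
    have : ∀ k : L.supp i, (k.1 = j) = False := fun k => by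
      simp only [eq_iff_iff, iff_false]
      rintro rfl
      exact hj k.2
    simp [this]
    norm_num

lemma winProb_strategy [Fintype E] [DecidableEq E] (hM : L.M ≠ 0) :
    (D.strategy hc).winProb (L.game hM) = 1 := by
  have h : ∀ i j, ((L.game hM).π i j : ℂ) * (∑ a, ∑ b,
      (if (L.game hM).V i j a b then 1 else 0) * (D.strategy hc).corr i j a b) =
        (L.game hM).π i j := by
    intro i j
    by_cases hij : L.M i j = 0
    · simp [game, hij]
    have hj : j ∈ L.supp i := by simpa [supp] using hij
    have hb : ∀ a : L.AliceOut i, (∑ b : L.BobOut j,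
        (if (L.game hM).V i j a b then 1 else 0) * (D.strategy hc).corr i j a b) =
          1 / 4 * 1 := by
      intro a
      -- Only `b = a_j` wins. It has probability `2/8`, and Alice has four possible outputs, so each
      -- question is won with probability 1.
      rw [Finset.sum_eq_single (a.1 ⟨j, hj⟩)]
      · rw [corr_strategy, dif_pos hj, CharTwo.add_self_eq_zero]
        simp [game]
        norm_num
      · intro b _ hb
        rw [if_neg, zero_mul]
        simp only [game, decide_eq_true_eq]
        exact fun h => hb (h hj).symm
      · simp
    rw [Finset.sum_congr rfl fun a _ => hb a, ← Finset.mul_sum,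
      sum_affine_one (by rw [Fintype.card_coe, hc])]
    norm_num
  have hπ := congrArg Complex.ofReal (L.game hM).π_sum
  push_cast at hπ
  rw [ACStrategy.winProb, Finset.sum_congr rfl fun i _ => Finset.sum_congr rfl fun j _ => h i j,
    hπ, norm_one]

end CorrelatedObservables

end Strategy

/-! ### Observables from the regular representations -/

section Regular

variable {E X : Type*} [Fintype X] [DecidableEq X] {L : LinSystem E X}

/-- The observables given by the left and right regular representations of the solution group. -/
noncomputable def regularObservables (L : LinSystem E X) (hJ : L.genJ ≠ 1)
    (hc : ∀ i, (L.supp i).card = 3) (hne : ∀ j, L.gen j ≠ 1 ∧ L.gen j ≠ L.genJ)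
    (hsep : ∀ j k, j ≠ k → L.gen j ≠ L.gen k ∧ L.gen j ≠ L.genJ * L.gen k) :
    L.CorrelatedObservables (EllTwo.negSubspace L.genJ) where
  A j := EllTwo.negLeft L.commute_genJ (L.gen j)
  B j := EllTwo.negRight L.genJ (L.gen j)
  ψ := EllTwo.negState L.genJ_mul_self
  isSelfAdjoint_A j := EllTwo.isSelfAdjoint_negLeft _ (L.gen_mul_self _)
  A_mul_self j := by rw [← EllTwo.negLeft_mul, gen_mul_self, EllTwo.negLeft_one]
  A_mul_A i x hx y hy z hz hxy hxz hyz := by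
    rw [← EllTwo.negLeft_mul, gen_mul_gen (hc i) hx hy hz hxy hxz hyz,
      EllTwo.negLeft_pow_mul]
  isSelfAdjoint_B j := EllTwo.isSelfAdjoint_negRight (L.gen_mul_self _)
  B_mul_self j := by rw [← EllTwo.negRight_mul, gen_mul_self, EllTwo.negRight_one]
  commute j k := EllTwo.negLeft_negRight _ _ _
  inner_self := by
    have h := EllTwo.inner_negState L.commute_genJ L.genJ_mul_self 1 1
    rwa [EllTwo.negLeft_one, EllTwo.negRight_one, if_pos rfl, mul_one, if_neg hJ.symm,
      sub_zero] at h
  inner_A j := by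
    have h := EllTwo.inner_negState L.commute_genJ L.genJ_mul_self (L.gen j) 1
    rwa [EllTwo.negRight_one, if_neg (hne j).1, mul_one, if_neg (hne j).2, sub_zero] at h
  inner_B j := by
    have h := EllTwo.inner_negState L.commute_genJ L.genJ_mul_self 1 (L.gen j)
    rwa [EllTwo.negLeft_one, if_neg (hne j).1.symm, if_neg, sub_zero] at h
    -- Here `1 = J x_j`; multiplying by `J` gives `x_j = J`.
    intro h1
    apply (hne j).2
    rw [← mul_right_inj L.genJ, ← h1, genJ_mul_self]
  inner_A_B j k := by
    rw [EllTwo.inner_negState]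
    by_cases hk : j = k
    · subst hk
      rw [if_pos rfl, if_pos rfl, if_neg, sub_zero]
      rw [eq_comm, mul_eq_right]
      exact hJ
    · rw [if_neg hk, if_neg (hsep _ _ hk).1, if_neg (hsep _ _ hk).2, sub_zero]

end Regular

/-! ### Characters separating generators -/

variable {E X : Type*} [Fintype X] {L : LinSystem E X}

/-- The character of the solution group, trivial on `J`, given by a solution of the homogeneous
system. -/
def character (f : X → ZMod 2) (hf : ∀ i, ∑ j ∈ L.supp i, f j = 0) :
    L.SolutionGroup →* Multiplicative (ZMod 2) :=
  PresentedGroup.toGroup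
    (f := fun o : Option X => o.elim 1 fun j => Multiplicative.ofAdd (f j)) (by
  have h2 : ∀ x : Multiplicative (ZMod 2), x ^ 2 = 1 := by decide
  rintro _ (j | j | _ | i | ⟨i, j, k, -, -⟩)
  · rw [map_commutatorElement, commutatorElement_eq_one_iff_commute]
    exact Commute.all _ _
  · rw [map_pow, h2]
  · rw [map_pow, h2]
  · rw [map_mul, map_inv, map_pow, FreeGroup.lift_apply_of, map_list_prod, List.map_map]
    have h : (FreeGroup.lift fun o : Option X => o.elim 1 fun j => Multiplicative.ofAdd (f j)) ∘
        (fun j => FreeGroup.of (some j)) = fun j => Multiplicative.ofAdd (f j) := by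
      ext j
      simp
    rw [h, Finset.prod_map_toList, ← ofAdd_sum, hf]
    simp
  · rw [map_commutatorElement, commutatorElement_eq_one_iff_commute]
    exact Commute.all _ _)

section

variable {f : X → ZMod 2} (hf : ∀ i, ∑ j ∈ L.supp i, f j = 0)

lemma character_gen (j : X) : character f hf (L.gen j) = Multiplicative.ofAdd (f j) :=
  PresentedGroup.toGroup.of _

lemma character_genJ : character f hf L.genJ = 1 :=
  PresentedGroup.toGroup.of _

include hf

/-- The character takes the same value at `1` and at `J`, so a single non-zero value excludes both.
-/
lemma gen_ne_one_and_ne_genJ {j : X} (hj : f j ≠ 0) : L.gen j ≠ 1 ∧ L.gen j ≠ L.genJ := by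
  constructor <;> intro h <;> apply hj <;> replace h := congrArg (character f hf) h
  · rwa [character_gen, map_one, ofAdd_eq_one] at h
  · rwa [character_gen, character_genJ, ofAdd_eq_one] at h

lemma gen_ne_gen_and_ne_genJ_mul_gen {j k : X} (hj : f j ≠ f k) :
    L.gen j ≠ L.gen k ∧ L.gen j ≠ L.genJ * L.gen k := by
  constructor <;> intro h <;> apply hj <;> replace h := congrArg (character f hf) h
  · rwa [character_gen, character_gen, Multiplicative.ofAdd.injective.eq_iff] at h
  · rwa [map_mul, character_gen, character_genJ, character_gen, one_mul,
      Multiplicative.ofAdd.injective.eq_iff] at h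

end

end LinSystem

namespace WagonWheel

/-! ### Parity and length of the words `φ₁(w)⁺` -/

section Words

lemma lift_eq_prod_toWord {T : Type*} [DecidableEq T] {G : Type*} [Group G] (f : T → G)
    (x : FreeGroup T) :
    FreeGroup.lift f x = (x.toWord.map fun t => cond t.2 (f t.1) (f t.1)⁻¹).prod := by
  conv_lhs => rw [← FreeGroup.mk_toWord (x := x)]
  exact FreeGroup.lift_mk

variable {S : Type*} [DecidableEq S]

/-- Every letter occurs an even number of times in `φ₁(w)⁺`. -/
lemma sum_map_plus_phi (w : FreeGroup S) (f : S × Bool → ZMod 2) :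
    ((plus (phi w)).map f).sum = 0 := by
  have hid : ∀ x y : Multiplicative (ZMod 2), x * y * x * y = 1 := by decide
  have hinv : ∀ x : Multiplicative (ZMod 2), x⁻¹ = x := by decide
  have h1 : (FreeGroup.lift fun t => Multiplicative.ofAdd (f t)).comp phi = 1 := by
    ext s
    simp only [phi, MonoidHom.comp_apply, FreeGroup.lift_apply_of, map_mul, hid,
      MonoidHom.one_apply]
  have h2 := (lift_eq_prod_toWord _ _).symm.trans (DFunLike.congr_fun h1 w)
  -- In a group of exponent 2 inverses are invisible, so the reduced word and its positive version
  -- have the same value.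
  simp only [hinv, Bool.cond_self, MonoidHom.one_apply] at h2
  have h3 := congrArg Multiplicative.toAdd h2
  rw [toAdd_list_sum, List.map_map] at h3
  rw [plus, List.map_map]
  exact h3

/-- Parity excludes length 1. In length 2 it forces both letters to agree, and reducedness then
forces the word `t²` or `t⁻²`, which a map to `ℤ/4` excludes. -/
lemma length_plus_phi (w : FreeGroup S) :
    (plus (phi w)).length ≠ 1 ∧ (plus (phi w)).length ≠ 2 := by
  constructor
  · intro h
    obtain ⟨t, ht⟩ := List.length_eq_one_iff.mp h
    have := sum_map_plus_phi w fun _ => 1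
    rw [ht] at this
    simp at this
  · intro h
    rw [plus, List.length_map] at h
    obtain ⟨⟨t, a⟩, ⟨u, b⟩, h⟩ := List.length_eq_two.mp h
    have htu := sum_map_plus_phi w fun x => if x = t then 1 else 0
    rw [plus, h] at htu
    have hut : u = t := by
      by_contra hut
      simp [hut] at htu
    subst hut
    have hred := FreeGroup.isReduced_toWord (x := phi w)
    rw [h] at hred
    have hab : a = b := by simpa [FreeGroup.IsReduced] using hred
    subst hab
    -- With `u_s ↦ -1` and `v_s ↦ 1` the word `u_s v_s u_s v_s` maps to 0, while `t^{±2}` maps to 2.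
    let g : S × Bool → Multiplicative (ZMod 4) := fun t => Multiplicative.ofAdd (cond t.2 1 3)
    have h1 : (FreeGroup.lift g).comp phi = 1 := by
      ext s
      simp only [phi, MonoidHom.comp_apply, FreeGroup.lift_apply_of, map_mul,
        MonoidHom.one_apply, g]
      decide
    have h2 := (lift_eq_prod_toWord _ _).symm.trans (DFunLike.congr_fun h1 w)
    rw [h] at h2
    obtain ⟨u, c⟩ := u
    simp only [List.map_cons, List.map_nil, List.prod_cons, List.prod_nil, g,
      MonoidHom.one_apply] at h2
    revert h2
    cases a <;> cases c <;> decide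

end Words

/-! ### Homogeneous solutions on the wheels -/

section Solutions

variable {T : Type*} {R' : Finset (ZMod 2 × List T)}

/-- The solutions of the homogeneous wheel system, parametrised by the values at the letters, at
the variables `a_i`, and by one bit for each wheel. -/
def solution (s : T → ZMod 2) (α : (r : R') → Fin r.1.2.length → ZMod 2) (δ : R' → ZMod 2) :
    Var R' → ZMod 2
  | .inl t => s t
  | .inr ⟨r, i, 0⟩ => α r i
  | .inr ⟨r, i, 1⟩ => s (r.1.2.get i) + α r i
  | .inr ⟨r, i, 2⟩ => s (r.1.2.get i) + α r i + α r (finRotate _ i)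
  | .inr ⟨r, i, 3⟩ => δ r + α r i + ((r.1.2.take i).map s).sum

lemma val_finRotate {n : ℕ} (i : Fin n) :
    (finRotate n i : ℕ) = if (i : ℕ) + 1 = n then 0 else (i : ℕ) + 1 := by
  obtain _ | n := n
  · exact i.elim0
  · rw [coe_finRotate]
    simp [Fin.ext_iff]

/-- Partial sums are well defined cyclically: at the last position the full sum is 0, which is also
the sum of the empty prefix. This lets the `d_i` close up around the wheel. -/
lemma sum_take_finRotate (l : List T) (s : T → ZMod 2) (hs : (l.map s).sum = 0)
    (i : Fin l.length) :
    ((l.take (finRotate _ i)).map s).sum = ((l.take i).map s).sum + s (l.get i) := by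
  have h : ((l.take (i + 1)).map s).sum = ((l.take i).map s).sum + s (l.get i) := by
    rw [List.take_add_one]
    simp
  rw [← h, val_finRotate]
  split_ifs with hi
  · rw [hi, List.take_length, hs]
    simp
  · rfl

lemma finRotate_ne {n : ℕ} (h1 : n ≠ 1) (i : Fin n) : finRotate n i ≠ i := by
  rw [Ne, Fin.ext_iff, val_finRotate]
  split_ifs <;> omega

lemma finRotate_finRotate_ne {n : ℕ} (h1 : n ≠ 1) (h2 : n ≠ 2) (i : Fin n) :
    finRotate n (finRotate n i) ≠ i := by
  rw [Ne, Fin.ext_iff, val_finRotate, val_finRotate]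
  split_ifs <;> omega

variable [DecidableEq T]

lemma supp_wheelSystem [Fintype T] (v : Vertex R') : (wheelSystem R').supp v = incident R' v := by
  ext x
  simp [LinSystem.supp, wheelSystem]

variable (h1 : ∀ r ∈ R', r.2.length ≠ 1)

include h1

/-- In a wheel of length 1, `d_i` and `d_{i+1}` would coincide and the inner vertex would have only
two variables. -/
lemma card_incident (v : Vertex R') : (incident R' v).card = 3 := by
  obtain ⟨r, i, k⟩ := v
  have h := finRotate_ne (h1 r r.2) i
  fin_cases k <;> refine Finset.card_eq_three.mpr ⟨_, _, _, ?_, ?_, ?_, rfl⟩ <;>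
    simp [h.symm, -finRotate_apply]

lemma sum_solution [Fintype T] (s : T → ZMod 2) (α : (r : R') → Fin r.1.2.length → ZMod 2)
    (δ : R' → ZMod 2) (hs : ∀ r ∈ R', (r.2.map s).sum = 0) (v : Vertex R') :
    ∑ x ∈ (wheelSystem R').supp v, solution s α δ x = 0 := by
  obtain ⟨r, i, k⟩ := v
  have h := finRotate_ne (h1 r r.2) i
  have h2 : ∀ x : ZMod 2, x + x = 0 := CharTwo.add_self_eq_zero
  rw [supp_wheelSystem]
  fin_cases k
  · change ∑ x ∈ {.inl (r.1.2.get i), .inr ⟨r, i, 0⟩, .inr ⟨r, i, 1⟩}, solution s α δ x = 0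
    rw [Finset.sum_insert (by simp), Finset.sum_insert (by simp), Finset.sum_singleton]
    simp only [solution]
    linear_combination h2 (s (r.1.2.get i)) + h2 (α r i)
  · change ∑ x ∈ {.inr ⟨r, i, 1⟩, .inr ⟨r, i, 2⟩, .inr ⟨r, finRotate _ i, 0⟩}, solution s α δ x = 0
    rw [Finset.sum_insert (by simp), Finset.sum_insert (by simp), Finset.sum_singleton]
    simp only [solution]
    linear_combination h2 (s (r.1.2.get i)) + h2 (α r i) + h2 (α r (finRotate _ i))
  · change ∑ x ∈ {.inr ⟨r, i, 2⟩, .inr ⟨r, i, 3⟩, .inr ⟨r, finRotate _ i, 3⟩}, solution s α δ x = 0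
    rw [Finset.sum_insert (by simp), Finset.sum_insert (by simp [h.symm, -finRotate_apply]), Finset.sum_singleton]
    simp only [solution]
    rw [sum_take_finRotate _ _ (hs r r.2)]
    -- The formula for `d_i` telescopes: `d_i + d_{i+1} = s_i + α_i + α_{i+1} = c_i`.
    linear_combination h2 (s (r.1.2.get i)) + h2 (α r i) + h2 (α r (finRotate _ i)) + h2 (δ r) +
      h2 ((r.1.2.take i).map s).sum

/-- Every ancillary variable is non-zero in some solution supported on its own wheel. -/
lemma exists_solution_eq_one (r : R') (i : Fin r.1.2.length) (k : Fin 4) :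
    ∃ α δ, solution (fun _ : T => 0) α δ (.inr ⟨r, i, k⟩) = 1 ∧
      (∀ t, solution (fun _ : T => 0) α δ (.inl t) = 0) ∧
      ∀ r' i' k', r' ≠ r → solution (fun _ : T => 0) α δ (.inr ⟨r', i', k'⟩) = 0 := by
  classical
  have h := finRotate_ne (h1 r r.2) i
  by_cases hk : k = 3
  · refine ⟨fun _ _ => 0, fun r' => if r' = r then 1 else 0, ?_, fun t => rfl, fun r' i' k' hr => ?_⟩
    · subst hk
      simp [solution]
    · fin_cases k' <;> simp [solution, hr]
  · refine ⟨fun r' i' => if (⟨r', i'⟩ : (r : R') × Fin r.1.2.length) = ⟨r, i⟩ then 1 else 0,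
      fun _ => 0, ?_, fun t => rfl, fun r' i' k' hr => ?_⟩
    · fin_cases k <;> simp_all [solution, -finRotate_apply]
    · fin_cases k' <;> simp [solution, hr]

lemma exists_solution_ne_zero (x : Var R') : ∃ s α δ, solution s α δ x ≠ 0 := by
  obtain t | ⟨r, i, k⟩ := x
  · exact ⟨fun _ => 1, fun _ _ => 0, fun _ => 0, one_ne_zero⟩
  · obtain ⟨α, δ, h, -⟩ := exists_solution_eq_one h1 r i k
    exact ⟨_, α, δ, by rw [h]; exact one_ne_zero⟩

/-- The solutions separate the variables of a wheel. -/
lemma exists_solution_ne_of_wheel (h2 : ∀ r ∈ R', r.2.length ≠ 2) (r : R')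
    (i i' : Fin r.1.2.length) (k k' : Fin 4) (hne : (i, k) ≠ (i', k')) (hk : k ≤ k') :
    ∃ s α δ, solution s α δ (.inr ⟨r, i, k⟩ : Var R') ≠ solution s α δ (.inr ⟨r, i', k'⟩) := by
  have hr1 := finRotate_ne (h1 r r.2)
  have hr2 := finRotate_finRotate_ne (h1 r r.2) (h2 r r.2)
  -- The indicator of the single variable `a` at position `i₀` of the wheel `r`; pairs are compared
  -- because positions in different wheels have different types.
  let e (i₀ : Fin r.1.2.length) (r' : R') (j : Fin r'.1.2.length) : ZMod 2 :=
    if (⟨r', j⟩ : (r : R') × Fin r.1.2.length) = ⟨r, i₀⟩ then 1 else 0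
  by_cases hkk : k = k'
  · subst hkk
    have hi : i' ≠ i := fun h => hne (by rw [h])
    by_cases hk2 : k = 2
    · subst hk2
      -- Raising `α` at `i` changes `c_i` and its predecessor. If `i'` is that predecessor, `α` is
      -- raised at `i + 1` instead; this leaves `c_{i'}` alone because the length is not 2.
      by_cases h : finRotate _ i' = i
      · refine ⟨fun _ => 0, e (finRotate _ i), fun _ => 0, ?_⟩
        subst h
        simp [solution, e, -finRotate_apply, (hr1 _).symm, (hr2 _).symm]
      · refine ⟨fun _ => 0, e i, fun _ => 0, ?_⟩
        simp [solution, e, -finRotate_apply, h, hr1, hi]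
    · refine ⟨fun _ => 0, e i, fun _ => 0, ?_⟩
      fin_cases k <;> simp_all [solution, e]
  by_cases hk3 : k' = 3
  · subst hk3
    -- The bit `δ` moves all the `d` and nothing else.
    refine ⟨fun _ => 0, fun _ _ => 0, fun _ => 1, ?_⟩
    fin_cases k <;> simp_all [solution]
  by_cases hk2 : k' = 2
  · subst hk2
    -- With `α` constantly 1, every `a` and `b` is 1 and every `c` is `1 + 1 = 0`.
    refine ⟨fun _ => 0, fun _ _ => 1, fun _ => 0, ?_⟩
    have : (1 : ZMod 2) + 1 = 0 := rfl
    fin_cases k <;> simp_all [solution]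
  obtain rfl : k = 0 := by omega
  obtain rfl : k' = 1 := by omega
  by_cases hi : i' = i
  · subst hi
    -- `a_i` and `b_i` differ by the letter `s_i`, so a non-zero letter value is needed.
    refine ⟨fun _ => 1, fun _ _ => 0, fun _ => 0, ?_⟩
    simp [solution]
  · refine ⟨fun _ => 0, e i, fun _ => 0, ?_⟩
    simp [solution, e, hi]

lemma exists_solution_ne (h2 : ∀ r ∈ R', r.2.length ≠ 2) {x y : Var R'} (hxy : x ≠ y) :
    ∃ s α δ, solution s α δ x ≠ solution s α δ y := by
  obtain t | ⟨r, i, k⟩ := x <;> obtain t' | ⟨r', i', k'⟩ := y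
  · refine ⟨fun u => if u = t then 1 else 0, fun _ _ => 0, fun _ => 0, ?_⟩
    have : t' ≠ t := fun h => hxy (by rw [h])
    simp [solution, this]
  · obtain ⟨α, δ, h, h', -⟩ := exists_solution_eq_one h1 r' i' k'
    exact ⟨_, α, δ, by rw [h, h']; exact zero_ne_one⟩
  · obtain ⟨α, δ, h, h', -⟩ := exists_solution_eq_one h1 r i k
    exact ⟨_, α, δ, by rw [h, h']; exact one_ne_zero⟩
  · by_cases hr : r' = r
    · subst hr
      rcases le_total k k' with hk | hk
      · refine exists_solution_ne_of_wheel h1 h2 r' i i' k k' (fun h => hxy ?_) hk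
        rw [Prod.mk.injEq] at h
        rw [h.1, h.2]
      · obtain ⟨s, α, δ, h⟩ := exists_solution_ne_of_wheel h1 h2 r' i' i k' k (fun h => hxy (by
          rw [Prod.mk.injEq] at h
          rw [h.1, h.2])) hk
        exact ⟨s, α, δ, h.symm⟩
    · obtain ⟨α, δ, h, -, h'⟩ := exists_solution_eq_one h1 r i k
      exact ⟨_, α, δ, by rw [h, h' _ _ _ hr]; exact one_ne_zero⟩

end Solutions

end WagonWheel

theorem proposition4p3 {S : Type*} [Fintype S] [DecidableEq S]
    (R : Finset (ZMod 2 × FreeGroup S))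
    (hM : (WagonWheel.system R).M ≠ 0)
    (hJ : (WagonWheel.system R).genJ ≠ 1) :
    ∃ 𝒮 : CommutingStrategy (WagonWheel.system R).AliceOut (WagonWheel.system R).BobOut
        (EllTwo.negSubspace (WagonWheel.system R).genJ),
      𝒮.winProb ((WagonWheel.system R).game hM) = 1 ∧
      (∀ i j (a : (WagonWheel.system R).AliceOut i) (b : ZMod 2),
        𝒮.corr i j a b =
          if h : j ∈ (WagonWheel.system R).supp i
          then (1 + (-1) ^ (a.1 ⟨j, h⟩ + b).val) / 8
          else 1 / 8) ∧
      (∀ i (j : (WagonWheel.system R).supp i) ξ,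
        ((WagonWheel.system R).obsA 𝒮 i j ξ : EllTwo (WagonWheel.system R).SolutionGroup) =
          EllTwo.leftReg ((WagonWheel.system R).gen j) ξ) ∧
      (∀ j ξ,
        ((WagonWheel.system R).obsB 𝒮 j ξ : EllTwo (WagonWheel.system R).SolutionGroup) =
          EllTwo.rightReg ((WagonWheel.system R).gen j) ξ) ∧
      (𝒮.ψ : EllTwo (WagonWheel.system R).SolutionGroup) =
        ((1 / Real.sqrt 2 : ℝ) : ℂ) •
          (EllTwo.ket 1 - EllTwo.ket (WagonWheel.system R).genJ) := by
  have hR : ∀ r ∈ WagonWheel.evenRelations R, ∃ w, r.2 = WagonWheel.plus (WagonWheel.phi w) := by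
    intro r hr
    obtain ⟨q, -, rfl⟩ := Finset.mem_image.mp hr
    exact ⟨q.2, rfl⟩
  have h1 : ∀ r ∈ WagonWheel.evenRelations R, r.2.length ≠ 1 := fun r hr => by
    obtain ⟨w, hw⟩ := hR r hr
    rw [hw]
    exact (WagonWheel.length_plus_phi w).1
  have h2 : ∀ r ∈ WagonWheel.evenRelations R, r.2.length ≠ 2 := fun r hr => by
    obtain ⟨w, hw⟩ := hR r hr
    rw [hw]
    exact (WagonWheel.length_plus_phi w).2
  have hsum : ∀ s : S × Bool → ZMod 2, ∀ r ∈ WagonWheel.evenRelations R, (r.2.map s).sum = 0 :=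
    fun s r hr => by
      obtain ⟨w, hw⟩ := hR r hr
      rw [hw]
      exact WagonWheel.sum_map_plus_phi w s
  have hc : ∀ v, ((WagonWheel.system R).supp v).card = 3 := fun v => by
    rw [WagonWheel.system, WagonWheel.supp_wheelSystem]
    exact WagonWheel.card_incident h1 v
  let D := LinSystem.regularObservables (WagonWheel.system R) hJ hc
    (fun x => by
      obtain ⟨s, α, δ, h⟩ := WagonWheel.exists_solution_ne_zero h1 x
      exact LinSystem.gen_ne_one_and_ne_genJ (WagonWheel.sum_solution h1 s α δ (hsum s)) h)
    (fun x y hxy => by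
      obtain ⟨s, α, δ, h⟩ := WagonWheel.exists_solution_ne h1 h2 hxy
      exact LinSystem.gen_ne_gen_and_ne_genJ_mul_gen (WagonWheel.sum_solution h1 s α δ (hsum s)) h)
  refine ⟨D.strategy hc, D.winProb_strategy hM, D.corr_strategy, fun i j ξ => ?_, fun j ξ => ?_,
    rfl⟩
  · rw [D.obsA_strategy]
    rfl
  · rw [D.obsB_strategy]
    rfl
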